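/- Let $k,s_1,s_2,s\ge 0$ be integers and let $R$ be a nonzero commutative ring (for instance $\mathbb Z$ or a field). **Diagrams.** A diagram on a finite set $V$ is an equivalence relation on two copies (top row and bottom row) of $V$; its classes are called components. A component meeting both rows is a through class, any other one is a horizontal edge, and $\sharp^p(d)$ is the number of through classes of $d$. To form $d\cdot d'$, place $d$ above $d'$ and identify the bottom row of $d$ with the top row of $d'$; restricting the generated equivalence relation to the outer rows gives the diagram $d\cdot d'$, and $l(d\cdot d')$ denotes the number of components (loops) lying entirely in the middle row. For an equivalence relation $e$ on $V$ and a set $P$ of its classes, let $U(e,P)$ be the diagram both of whose rows are $e$, in which every class in $P$ is joined to its own copy in the other row, all other classes being horizontal edges. **Index sets.** (a) Let $V=\{1,\dots,k\}\times\mathbb Z_2$, with $\mathbb Z_2$ acting on the second factor. In a $\mathbb Z_2$-stable diagram, an $\{e\}$-component contains no two distinct points of one $\mathbb Z_2$-orbit (these components come in pairs), and a $\mathbb Z_2$-component is a union of orbits. Let $J^{2k}_{2s_1+s_2}$ be the set of $\mathbb Z_2$-stable diagrams of the form $U(e,P)$ with $s_1$ pairs of $\{e\}$-through classes and $s_2$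 $\mathbb Z_2$-through classes. For such $d$ let $r_1(d)$ be the number of pairs of $\{e\}$-horizontal edges and $r_2(d)$ the number of $\mathbb Z_2$-horizontal edges in the top row. Let $\alpha(d)=(\alpha_1,\alpha_2,\alpha_3,\alpha_4)$, where the $\alpha_i$ are the partitions formed by the sizes (numbers of orbits in the top row) of, respectively, the pairs of $\{e\}$-through classes, the $\mathbb Z_2$-through classes, the pairs of top $\{e\}$-horizontal edges and the top $\mathbb Z_2$-horizontal edges. (b) Let $\overrightarrow J^{2k}_{2s_1+s_2}\subseteq J^{2k}_{2s_1+s_2}$ consist of the $d$ such that $s_1+s_2+r_1(d)+r_2(d)\le k-1$, or $s_1+s_2+r_1(d)+r_2(d)=k$ and ($r_1(d)\ne0$ or $s_1=k$). (c) Let $J^k_s$ be the set of diagrams of the form $U(e,P)$ on $V=\{1,\dots,k\}$ with $s$ through classes. Let $r(d)$ be the number of horizontal edges in the top row, and let $\alpha(d)=(\alpha_1,\alpha_2)$ be the partitions formed by the numbers of top-row vertices of the through classes and of the top horizontal edges. **Orders.** Fix any strict total order on the possible values of $\alpha$ (for example a lexicographic one). In cases (a) and (b), order the index set totally, first by $2r_1+r_2$,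 then by $r_1+r_2$, then by $\alpha$, with ties broken arbitrarily. In case (c), order it totally, first by $r$, then by $\alpha$, with ties broken arbitrarily. **Gram matrices.** The Gram matrices $G^k_{2s_1+s_2}$, $\overrightarrow G^k_{2s_1+s_2}$ and $G^k_s$ are indexed by $J^{2k}_{2s_1+s_2}$, $\overrightarrow J^{2k}_{2s_1+s_2}$ and $J^k_s$ respectively. With $t=2s_1+s_2$ in the first two cases and $t=s$ in the third, the $(d,d')$ entry is $x^{l(d\cdot d')}\in R[x]$ if $\sharp^p(d\cdot d')=t$, and $0$ otherwise. **Lemma 3.9.** (i) In each of the three cases, for all $d_i,d_j$ in the index set with $d_j$ preceding $d_i$ we have $l(d_i\cdot d_j)\le l(d_i\cdot d_i)$, and $$l(d_i\cdot d_j)<l(d_i\cdot d_i)$$ whenever $\sharp^p(d_i\cdot d_j)=t$ (that is, whenever the corresponding entry of the Gram matrix is nonzero) or $(r_1(d_j),r_2(d_j))\neq(r_1(d_i),r_2(d_i))$ (in case (c): $r(d_j)\ne r(d_i)$). (ii) The determinants $\det G^k_{2s_1+s_2}$, $\det\overrightarrow G^k_{2s_1+s_2}$ and $\det G^k_s$ are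 nonzero polynomials in $x$ with leading coefficient $1$. (An empty matrix has determinant $1$.) -/

import Mathlib

open Polynomial

namespace GramDiag

/-! ### Partition diagrams on two rows of vertices -/

section Diagrams

variable {V : Type}

/-- A partition diagram with vertex set `V` in each row: an equivalence relation on the disjoint
union of the top row (`Sum.inl`) and the bottom row (`Sum.inr`). Its equivalence classes are the
connected components. -/
abbrev Diagram (V : Type) : Type := Setoid (V ⊕ V)

/-- The through classes: connected components that meet both rows. -/
def throughClasses (d : Diagram V) : Set (Set (V ⊕ V)) :=
  {C | C ∈ d.classes ∧ (∃ v, Sum.inl v ∈ C) ∧ (∃ w, Sum.inr w ∈ C)}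

/-- The horizontal edges of the top row: connected components contained in the top row. -/
def topEdges (d : Diagram V) : Set (Set (V ⊕ V)) :=
  {C | C ∈ d.classes ∧ ∀ x ∈ C, ∃ v, x = Sum.inl v}

/-- The propagating number: the number of through classes. -/
noncomputable def propagating (d : Diagram V) : ℕ := (throughClasses d).ncard

/-- Two rows as the upper two (top, middle) of the three rows `V ⊕ (V ⊕ V)`
(top, middle, bottom). -/
def upper : V ⊕ V → V ⊕ (V ⊕ V) := Sum.map id Sum.inl

/-- Two rows as the lower two (middle, bottom) of three rows. -/
def lower : V ⊕ V → V ⊕ (V ⊕ V) := Sum.inr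

/-- Two rows as the outer two (top, bottom) of three rows. -/
def outer : V ⊕ V → V ⊕ (V ⊕ V) := Sum.map id Sum.inr

/-- `d` placed above `d'`, the bottom row of `d` being identified with the top row of `d'`. -/
def stack (d d' : Diagram V) : Setoid (V ⊕ (V ⊕ V)) :=
  Relation.EqvGen.setoid fun x y =>
    (∃ a b, d a b ∧ x = upper a ∧ y = upper b) ∨ (∃ a b, d' a b ∧ x = lower a ∧ y = lower b)

/-- The diagram underlying the product of `d` and `d'`. -/
def comp (d d' : Diagram V) : Diagram V := (stack d d').comap outer

/-- The number of loops in the product of `d` and `d'`: the number of connected components of the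
stacked diagram that lie entirely in the middle row. -/
noncomputable def loops (d d' : Diagram V) : ℕ :=
  {C | C ∈ (stack d d').classes ∧ ∀ x ∈ C, ∃ v, x = Sum.inr (Sum.inl v)}.ncard

/-- The vertex of `V` above or below which a vertex lies. -/
def fold : V ⊕ V → V := Sum.elim id id

/-- The diagram whose top and bottom rows are both the partition `e`, in which each component
belonging to `P` is joined to its own copy in the other row (the identity permutation of the
through classes), and the other components are horizontal edges. -/
def doubled (e : Setoid V) (P : Set (Quotient e)) : Diagram V where
  r a b := e (fold a) (fold b) ∧ (a.isLeft = b.isLeft ∨ Quotient.mk e (fold a) ∈ P)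
  iseqv :=
    { refl := fun _ => ⟨e.refl _, Or.inl rfl⟩
      symm := fun {a b} h => by
        refine ⟨e.symm h.1, h.2.imp Eq.symm fun hP => ?_⟩
        rwa [← Quotient.sound (s := e) h.1]
      trans := fun {a b c} h h' => by
        refine ⟨e.trans h.1 h'.1, ?_⟩
        rcases h.2 with h2 | h2
        · rcases h'.2 with h3 | h3
          · exact Or.inl (h2.trans h3)
          · right
            rwa [Quotient.sound (s := e) h.1]
        · exact Or.inr h2 }

/-- The diagrams of the form `doubled e P`. -/
def IsDoubled (d : Diagram V) : Prop := ∃ (e : Setoid V) (P : Set (Quotient e)), d = doubled e P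

noncomputable instance [Finite V] (S : Set (Diagram V)) : Fintype S :=
  have : Finite (Diagram V) :=
    Finite.of_injective (fun d : Diagram V => fun a b => d a b) fun d d' h =>
      Setoid.ext fun a b => iff_of_eq (congrFun (congrFun h a) b)
  Fintype.ofFinite S

noncomputable instance (S : Set (Diagram V)) : DecidableEq S := Classical.decEq S

/-- The Gram matrix on a set `S` of diagrams with `t` through classes: the entry at `(d, d')` is
`x ^ l(d · d')` if `d · d'` has `t` through classes, and `0` otherwise. -/
noncomputable def gram (R : Type*) [CommRing R] (S : Set (Diagram V)) (t : ℕ) :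
    Matrix S S R[X] :=
  open Classical in
  fun d d' => if propagating (comp d.1 d'.1) = t then X ^ loops d.1 d'.1 else 0

/-- For a family of disjoint nonempty vertex sets, the multiset of their numbers of top-row
vertices. -/
noncomputable def sizes [Finite V] (S : Set (Set (V ⊕ V))) : Multiset ℕ :=
  (Set.toFinite S).toFinset.val.map fun C => {v : V | Sum.inl v ∈ C}.ncard

end Diagrams

/-! ### `ℤ₂`-stable diagrams -/

section Signed

variable {k : ℕ}

/-- The vertices of one row: `k` points times the group `ℤ₂` (written additively). -/
abbrev Row (k : ℕ) : Type := Fin k × ZMod 2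

/-- The action of `ℤ₂` on the vertices. -/
def act (g : ZMod 2) : Row k ⊕ Row k → Row k ⊕ Row k :=
  Sum.map (fun v => (v.1, g + v.2)) (fun v => (v.1, g + v.2))

def IsStable (d : Diagram (Row k)) : Prop := ∀ g p q, d p q → d (act g p) (act g q)

/-- `{e}`-components: no two distinct points of an orbit are connected. -/
def IsEComp (C : Set (Row k ⊕ Row k)) : Prop := ∀ x ∈ C, ∀ g, act g x ∈ C → g = 0

/-- `ℤ₂`-components: unions of orbits. -/
def IsZComp (C : Set (Row k ⊕ Row k)) : Prop := ∀ x ∈ C, ∀ g, act g x ∈ C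

/-- The image of a component in the quotient by `ℤ₂`. A pair of `{e}`-components `C^e, C^g` has one
common image, so counting images of `{e}`-components means counting pairs. -/
def orbits (C : Set (Row k ⊕ Row k)) : Set (Fin k ⊕ Fin k) := Sum.map Prod.fst Prod.fst '' C

def eThrough (d : Diagram (Row k)) : Set (Set (Fin k ⊕ Fin k)) :=
  orbits '' {C | C ∈ throughClasses d ∧ IsEComp C}

def zThrough (d : Diagram (Row k)) : Set (Set (Fin k ⊕ Fin k)) :=
  orbits '' {C | C ∈ throughClasses d ∧ IsZComp C}

def eEdges (d : Diagram (Row k)) : Set (Set (Fin k ⊕ Fin k)) :=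
  orbits '' {C | C ∈ topEdges d ∧ IsEComp C}

def zEdges (d : Diagram (Row k)) : Set (Set (Fin k ⊕ Fin k)) :=
  orbits '' {C | C ∈ topEdges d ∧ IsZComp C}

/-- The number `r₁` of pairs of `{e}`-horizontal edges in the top row. -/
noncomputable def r1 (d : Diagram (Row k)) : ℕ := (eEdges d).ncard

/-- The number `r₂` of `ℤ₂`-horizontal edges in the top row. -/
noncomputable def r2 (d : Diagram (Row k)) : ℕ := (zEdges d).ncard

/-- The set `J^{2k}_{2s₁+s₂}`: the `ℤ₂`-stable diagrams with equal top and bottom rows and identity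
permutation, having `s₁` pairs of `{e}`-through classes and `s₂` `ℤ₂`-through classes. -/
def J (k s₁ s₂ : ℕ) : Set (Diagram (Row k)) :=
  {d | IsStable d ∧ IsDoubled d ∧ (eThrough d).ncard = s₁ ∧ (zThrough d).ncard = s₂}

/-- The subset of `J` that belongs to the signed partition algebra. -/
def JSigned (k s₁ s₂ : ℕ) : Set (Diagram (Row k)) :=
  {d | d ∈ J k s₁ s₂ ∧ (s₁ + s₂ + r1 d + r2 d < k ∨
    (s₁ + s₂ + r1 d + r2 d = k ∧ (r1 d ≠ 0 ∨ s₁ = k)))}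

/-- Quadruples of integer partitions, each given as the multiset of its parts. -/
abbrev Shape : Type := Multiset ℕ × Multiset ℕ × Multiset ℕ × Multiset ℕ

/-- The underlying partition `α = (α₁, α₂, α₃, α₄)` of a diagram. -/
noncomputable def shape (d : Diagram (Row k)) : Shape :=
  (sizes (eThrough d), sizes (zThrough d), sizes (eEdges d), sizes (zEdges d))

/-- The rules that order diagrams: first by `2r₁ + r₂`, then by `r₁ + r₂`, then by the underlying
partition. -/
def RankLT (lt : Shape → Shape → Prop) (d d' : Diagram (Row k)) : Prop :=
  2 * r1 d + r2 d < 2 * r1 d' + r2 d' ∨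
  (2 * r1 d + r2 d = 2 * r1 d' + r2 d' ∧ r1 d + r2 d < r1 d' + r2 d') ∨
  (2 * r1 d + r2 d = 2 * r1 d' + r2 d' ∧ r1 d + r2 d = r1 d' + r2 d' ∧ lt (shape d) (shape d'))

/-- `r` is a strict total order on `S` that obeys the ordering rules (ties are broken arbitrarily),
where `lt` is the order used to compare underlying partitions. -/
def IsIndexOrder (S : Set (Diagram (Row k))) (lt : Shape → Shape → Prop) (r : S → S → Prop) :
    Prop :=
  IsStrictTotalOrder S r ∧ ∀ d d' : S, RankLT lt d.1 d'.1 → r d d'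

end Signed

/-! ### The diagrams of the partition algebra -/

section Plain

variable {k : ℕ}

/-- The set `J^k_s`: the partition diagrams on `k` points with equal top and bottom rows and
identity permutation, having `s` through classes. -/
def JPlain (k s : ℕ) : Set (Diagram (Fin k)) := {d | IsDoubled d ∧ propagating d = s}

/-- The number of horizontal edges in the top row. -/
noncomputable def rPlain (d : Diagram (Fin k)) : ℕ := (topEdges d).ncard

/-- The underlying partition `(α₁, α₂)` of a diagram. -/
noncomputable def shapePlain (d : Diagram (Fin k)) : Multiset ℕ × Multiset ℕ :=
  (sizes (throughClasses d), sizes (topEdges d))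

def RankLTPlain (lt : Multiset ℕ × Multiset ℕ → Multiset ℕ × Multiset ℕ → Prop)
    (d d' : Diagram (Fin k)) : Prop :=
  rPlain d < rPlain d' ∨ (rPlain d = rPlain d' ∧ lt (shapePlain d) (shapePlain d'))

def IsIndexOrderPlain (S : Set (Diagram (Fin k)))
    (lt : Multiset ℕ × Multiset ℕ → Multiset ℕ × Multiset ℕ → Prop) (r : S → S → Prop) : Prop :=
  IsStrictTotalOrder S r ∧ ∀ d d' : S, RankLTPlain lt d.1 d'.1 → r d d'

end Plain

end GramDiag

/-! Stack `doubled e P` on `doubled e' P'`. The middle row is glued by both partitions, so its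
components are the classes of `e ⊔ e'`. With f, f' the maps sending classes of e, e' to classes of
the join, the loops are the join classes outside f(P) ∪ f'(P'), and the through classes of the
product correspond to f(P) ∩ f'(P').

Every loop is the f-image of a class outside P and the f'-image of a class outside P'. Hence the
number of loops is at most the number of horizontal edges in the top row of either diagram, and d ·
d attains this bound. If it is attained for both diagrams, f and f' restrict to bijections from the
horizontal classes to the loops, and the horizontal edges agree (`topEdges_eq_of_loops_eq`). If
moreover no through class is lost, f and f' are injective, so e = e ⊔ e' = e' and the diagrams
coincide (`eq_of_loops_eq`).

In the ℤ₂ cases the first ordering key 2r₁ + r₂ is the number of top horizontal edges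
(`ncard_topEdges_of_isStable`), so an earlier diagram has at most as many; this gives (i). For (ii),
a nonzero off-diagonal entry has degree below the mean of the two diagonal degrees, so only the
identity permutation reaches the top degree (`monic_det_of_natDegree`). -/

namespace GramDiag

/-! ### Counting the classes of a kernel by labels -/

section Counting

theorem ncard_classes_ker {A B : Type*} (f : A → B) (Q : Set A → Prop) :
    {C | C ∈ (Setoid.ker f).classes ∧ Q C}.ncard =
      {b | b ∈ Set.range f ∧ Q (f ⁻¹' {b})}.ncard := by
  have h : {C | C ∈ (Setoid.ker f).classes ∧ Q C} =
      (fun b => f ⁻¹' {b}) '' {b | b ∈ Set.range f ∧ Q (f ⁻¹' {b})} := by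
    ext C
    constructor
    · rintro ⟨⟨y, rfl⟩, hQ⟩
      exact ⟨f y, ⟨⟨y, rfl⟩, hQ⟩, rfl⟩
    · rintro ⟨b, ⟨⟨y, rfl⟩, hQ⟩, rfl⟩
      exact ⟨⟨y, rfl⟩, hQ⟩
  rw [h]
  apply Set.InjOn.ncard_image
  rintro _ ⟨⟨y, rfl⟩, -⟩ _ ⟨⟨z, rfl⟩, -⟩ h
  have : y ∈ f ⁻¹' {f z} := by
    have h' : f ⁻¹' {f y} = f ⁻¹' {f z} := h
    rw [← h']; rfl
  exact this

end Counting

/-! ### Through classes and horizontal edges of a doubled diagram -/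

section Doubled

variable {V : Type}

open Classical in
/-- Separates the components of `doubled e P`. -/
noncomputable def label (e : Setoid V) (P : Set (Quotient e)) (a : V ⊕ V) : Quotient e × Bool :=
  (Quotient.mk e (fold a), if Quotient.mk e (fold a) ∈ P then true else a.isLeft)

theorem doubled_eq_ker (e : Setoid V) (P : Set (Quotient e)) :
    doubled e P = Setoid.ker (label e P) := by
  ext a b
  rw [Setoid.ker_def]
  simp only [label, Prod.mk.injEq, Quotient.eq]
  constructor
  · rintro ⟨h, h'⟩
    refine ⟨h, ?_⟩
    rw [← Quotient.sound (s := e) h]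
    split_ifs with hP
    · rfl
    · exact h'.resolve_right hP
  · rintro ⟨h, h'⟩
    refine ⟨h, ?_⟩
    rw [← Quotient.sound (s := e) h] at h'
    split_ifs at h' with hP
    · exact Or.inr hP
    · exact Or.inl h'

/-- A label is attained in both rows exactly when it is (q, `true`) with q ∈ P; outside P the flag
records the row. -/
theorem propagating_doubled (e : Setoid V) (P : Set (Quotient e)) :
    propagating (doubled e P) = P.ncard := by
  rw [propagating, throughClasses, doubled_eq_ker, ncard_classes_ker,
    ← Set.ncard_image_of_injective P (Prod.mk_left_injective true)]
  congr 1
  ext ⟨q, b⟩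
  simp only [Set.mem_ofPred_eq, Set.mem_range, Set.mem_preimage, Set.mem_singleton_iff, label,
    Set.mem_image, Prod.mk.injEq]
  constructor
  · rintro ⟨-, ⟨v, rfl, h⟩, ⟨w, hw, h'⟩⟩
    by_cases hP : Quotient.mk e (fold (Sum.inr w)) ∈ P
    · rw [if_pos hP] at h'
      exact ⟨_, hP, hw, h'⟩
    · rw [if_neg hP] at h'
      rw [if_neg (hw ▸ hP)] at h
      exact absurd (h.trans h'.symm) (by simp)
  · rintro ⟨q, hq, rfl, rfl⟩
    induction q using Quotient.inductionOn with
    | h v =>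
      exact ⟨⟨Sum.inl v, rfl, by simp⟩, ⟨v, rfl, by simp⟩, ⟨v, rfl, by simp [fold, hq]⟩⟩

theorem ncard_topEdges_doubled (e : Setoid V) (P : Set (Quotient e)) :
    (topEdges (doubled e P)).ncard = Pᶜ.ncard := by
  rw [topEdges, doubled_eq_ker, ncard_classes_ker,
    ← Set.ncard_image_of_injective Pᶜ (Prod.mk_left_injective true)]
  congr 1
  ext ⟨q, b⟩
  simp only [Set.mem_ofPred_eq, Set.mem_range, Set.mem_preimage, Set.mem_singleton_iff, label,
    Set.mem_image, Prod.mk.injEq]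
  constructor
  · rintro ⟨⟨a, rfl, h⟩, h'⟩
    obtain ⟨v, rfl⟩ := h' a ⟨rfl, h⟩
    refine ⟨_, fun hP => ?_, rfl, ?_⟩
    · obtain ⟨w, hw⟩ := h' (Sum.inr v) ⟨rfl, by rw [← h]; simp [fold] at hP ⊢; simp [hP]⟩
      cases hw
    · simpa using h
  · rintro ⟨q, hq, rfl, rfl⟩
    induction q using Quotient.inductionOn with
    | h v =>
      refine ⟨⟨Sum.inl v, rfl, by simp⟩, ?_⟩
      rintro (w | w) ⟨h, h'⟩
      · exact ⟨w, rfl⟩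
      · rw [h, if_neg hq] at h'
        cases h'

theorem mem_topEdges_doubled {e : Setoid V} {P : Set (Quotient e)} {C : Set (V ⊕ V)} :
    C ∈ topEdges (doubled e P) ↔ ∃ v, Quotient.mk e v ∉ P ∧ C = Sum.inl '' {w | e v w} := by
  constructor
  · rintro ⟨⟨a, rfl⟩, h⟩
    obtain ⟨v, rfl⟩ := h a ((doubled e P).refl a)
    have hv : Quotient.mk e v ∉ P := fun hP => by
      obtain ⟨w, hw⟩ := h (Sum.inr v) ⟨e.refl v, Or.inr hP⟩
      cases hw
    refine ⟨v, hv, Set.ext fun x => ⟨fun hx => ?_, ?_⟩⟩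
    · obtain ⟨w, rfl⟩ := h x hx
      exact ⟨w, e.symm hx.1, rfl⟩
    · rintro ⟨w, hw, rfl⟩
      exact ⟨e.symm hw, Or.inl rfl⟩
  · rintro ⟨v, hv, rfl⟩
    refine ⟨⟨Sum.inl v, Set.ext fun x => ⟨?_, fun hx => ?_⟩⟩, ?_⟩
    · rintro ⟨w, hw, rfl⟩
      exact ⟨e.symm hw, Or.inl rfl⟩
    · have hx' : e v (fold x) := e.symm hx.1
      rcases x with w | w
      · exact ⟨w, hx', rfl⟩
      · rcases hx.2 with h | h
        · cases h
        · exact absurd (by rwa [Quotient.sound (s := e) hx.1] at h) hv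
    · rintro _ ⟨w, -, rfl⟩
      exact ⟨w, rfl⟩

end Doubled

/-! ### Loops and through classes of a product via the join -/

section Stack

variable {V : Type} (e e' : Setoid V) (P : Set (Quotient e)) (P' : Set (Quotient e'))

/-- The class of the join containing a class of the first partition. -/
def toSupLeft : Quotient e → Quotient (e ⊔ e') :=
  Quotient.map' id fun _ _ h => (le_sup_left : e ≤ e ⊔ e') h

/-- The class of the join containing a class of the second partition. -/
def toSupRight : Quotient e' → Quotient (e ⊔ e') :=
  Quotient.map' id fun _ _ h => (le_sup_right : e' ≤ e ⊔ e') h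

theorem toSupLeft_mk (v : V) : toSupLeft e e' (Quotient.mk e v) = Quotient.mk (e ⊔ e') v := rfl

theorem toSupRight_mk (v : V) : toSupRight e e' (Quotient.mk e' v) = Quotient.mk (e ⊔ e') v := rfl

theorem toSupLeft_surjective : Function.Surjective (toSupLeft e e') := fun M => by
  induction M using Quotient.inductionOn with
  | h v => exact ⟨Quotient.mk e v, rfl⟩

theorem toSupRight_surjective : Function.Surjective (toSupRight e e') := fun M => by
  induction M using Quotient.inductionOn with
  | h v => exact ⟨Quotient.mk e' v, rfl⟩

open Classical in
/-- Separates the components of the stacked diagram of `doubled e P` and `doubled e' P'`. -/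
noncomputable def stackLabel :
    V ⊕ (V ⊕ V) → Quotient (e ⊔ e') ⊕ (Quotient e ⊕ Quotient e') :=
  Sum.elim
    (fun v => if Quotient.mk e v ∈ P then Sum.inl (Quotient.mk _ v)
      else Sum.inr (Sum.inl (Quotient.mk e v)))
    (Sum.elim (fun v => Sum.inl (Quotient.mk _ v))
      (fun v => if Quotient.mk e' v ∈ P' then Sum.inl (Quotient.mk _ v)
        else Sum.inr (Sum.inr (Quotient.mk e' v))))

/-- An outer vertex reaches the middle row exactly when its class lies in P (top) or P' (bottom);
otherwise its component stays in its own row. -/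
theorem stack_doubled :
    stack (doubled e P) (doubled e' P') = Setoid.ker (stackLabel e e' P P') := by
  have hl {v w : V} (h : e v w) : Quotient.mk (e ⊔ e') v = Quotient.mk (e ⊔ e') w :=
    Quotient.sound ((le_sup_left : e ≤ e ⊔ e') h)
  have hr {v w : V} (h : e' v w) : Quotient.mk (e ⊔ e') v = Quotient.mk (e ⊔ e') w :=
    Quotient.sound ((le_sup_right : e' ≤ e ⊔ e') h)
  apply le_antisymm
  · apply Setoid.eqvGen_le
    rintro _ _ (⟨a, b, ⟨h, h'⟩, rfl, rfl⟩ | ⟨a, b, ⟨h, h'⟩, rfl, rfl⟩)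
    · have h1 := Quotient.sound (s := e) h
      have h2 := hl h
      rw [Setoid.ker_def]
      rcases a with a | a <;> rcases b with b | b <;>
        simp only [fold, Sum.elim_inl, Sum.elim_inr, id] at h1 h2 h' <;>
        simp_all [upper, stackLabel]
      rw [h1]
    · have h1 := Quotient.sound (s := e') h
      have h2 := hr h
      rw [Setoid.ker_def]
      rcases a with a | a <;> rcases b with b | b <;>
        simp only [fold, Sum.elim_inl, Sum.elim_inr, id] at h1 h2 h' <;>
        simp_all [lower, stackLabel]
      rw [h1]
  · set s := stack (doubled e P) (doubled e' P') with hs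
    have up {a b : V ⊕ V} (h : doubled e P a b) : s (upper a) (upper b) :=
      Relation.EqvGen.rel _ _ (Or.inl ⟨a, b, h, rfl, rfl⟩)
    have low {a b : V ⊕ V} (h : doubled e' P' a b) : s (lower a) (lower b) :=
      Relation.EqvGen.rel _ _ (Or.inr ⟨a, b, h, rfl, rfl⟩)
    have mid {v w : V} (h : (e ⊔ e') v w) : s (Sum.inr (Sum.inl v)) (Sum.inr (Sum.inl w)) := by
      have : e ⊔ e' ≤ s.comap (fun v => Sum.inr (Sum.inl v)) := by
        refine sup_le (fun v w h => ?_) (fun v w h => ?_)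
        · exact up (a := Sum.inr v) (b := Sum.inr w) ⟨h, Or.inl rfl⟩
        · exact low (a := Sum.inl v) (b := Sum.inl w) ⟨h, Or.inl rfl⟩
      exact this h
    have top {v : V} (h : Quotient.mk e v ∈ P) : s (Sum.inl v) (Sum.inr (Sum.inl v)) :=
      up (a := Sum.inl v) (b := Sum.inr v) ⟨e.refl v, Or.inr h⟩
    have bot {v : V} (h : Quotient.mk e' v ∈ P') : s (Sum.inr (Sum.inr v)) (Sum.inr (Sum.inl v)) :=
      low (a := Sum.inr v) (b := Sum.inl v) ⟨e'.refl v, Or.inr h⟩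
    -- A vertex labelled by a join class is connected to the middle row, so two vertices with that
    -- label are linked through `mid`; the other labels never leave an outer row.
    have toMid (x : V ⊕ (V ⊕ V)) (M) (h : stackLabel e e' P P' x = Sum.inl M) :
        ∃ v, Quotient.mk _ v = M ∧ s x (Sum.inr (Sum.inl v)) := by
      rcases x with v | v | v <;> simp only [stackLabel, Sum.elim_inl, Sum.elim_inr] at h
      · split_ifs at h with hv
        exact ⟨v, Sum.inl_injective h, top hv⟩
      · exact ⟨v, Sum.inl_injective h, s.refl _⟩
      · split_ifs at h with hv
        exact ⟨v, Sum.inl_injective h, bot hv⟩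
    have toTop (x : V ⊕ (V ⊕ V)) (q) (h : stackLabel e e' P P' x = Sum.inr (Sum.inl q)) :
        ∃ v, Quotient.mk _ v = q ∧ x = Sum.inl v := by
      rcases x with v | v | v <;> simp only [stackLabel, Sum.elim_inl, Sum.elim_inr] at h
      · split_ifs at h with hv
        exact ⟨v, by simpa using h, rfl⟩
      · cases h
      · split_ifs at h with hv
        simp at h
    have toBot (x : V ⊕ (V ⊕ V)) (q) (h : stackLabel e e' P P' x = Sum.inr (Sum.inr q)) :
        ∃ v, Quotient.mk _ v = q ∧ x = Sum.inr (Sum.inr v) := by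
      rcases x with v | v | v <;> simp only [stackLabel, Sum.elim_inl, Sum.elim_inr] at h
      · split_ifs at h with hv
        simp at h
      · cases h
      · split_ifs at h with hv
        exact ⟨v, by simpa using h, rfl⟩
    intro x y hxy
    rw [Setoid.ker_def] at hxy
    rcases hx : stackLabel e e' P P' x with M | q | q <;> rw [hx] at hxy
    · obtain ⟨v, rfl, hv⟩ := toMid x M hx
      obtain ⟨w, hw, hw'⟩ := toMid y _ hxy.symm
      exact s.trans hv (s.trans (mid (Quotient.exact hw.symm)) (s.symm hw'))
    · obtain ⟨v, rfl, rfl⟩ := toTop x q hx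
      obtain ⟨w, hw, rfl⟩ := toTop y _ hxy.symm
      exact up (a := Sum.inl v) (b := Sum.inl w) ⟨Quotient.exact hw.symm, Or.inl rfl⟩
    · obtain ⟨v, rfl, rfl⟩ := toBot x q hx
      obtain ⟨w, hw, rfl⟩ := toBot y _ hxy.symm
      exact low (a := Sum.inr v) (b := Sum.inr w) ⟨Quotient.exact hw.symm, Or.inl rfl⟩

theorem stackLabel_top_eq_inl {v : V} {M : Quotient (e ⊔ e')} :
    stackLabel e e' P P' (Sum.inl v) = Sum.inl M ↔
      Quotient.mk e v ∈ P ∧ toSupLeft e e' (Quotient.mk e v) = M := by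
  simp only [stackLabel, Sum.elim_inl, toSupLeft_mk]
  split_ifs with h <;> simp [h]

theorem stackLabel_bottom_eq_inl {v : V} {M : Quotient (e ⊔ e')} :
    stackLabel e e' P P' (Sum.inr (Sum.inr v)) = Sum.inl M ↔
      Quotient.mk e' v ∈ P' ∧ toSupRight e e' (Quotient.mk e' v) = M := by
  simp only [stackLabel, Sum.elim_inr, toSupRight_mk]
  split_ifs with h <;> simp [h]

theorem loops_doubled :
    loops (doubled e P) (doubled e' P') =
      {M | M ∉ toSupLeft e e' '' P ∧ M ∉ toSupRight e e' '' P'}.ncard := by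
  rw [loops, stack_doubled, ncard_classes_ker, ← Set.ncard_image_of_injective
    {M | M ∉ toSupLeft e e' '' P ∧ M ∉ toSupRight e e' '' P'} Sum.inl_injective]
  congr 1
  ext b
  constructor
  · rintro ⟨⟨x, rfl⟩, h⟩
    obtain ⟨v, rfl⟩ := h x rfl
    refine ⟨Quotient.mk _ v, ⟨?_, ?_⟩, rfl⟩
    · rintro ⟨q, hq, hq'⟩
      induction q using Quotient.inductionOn with
      | h w =>
        obtain ⟨u, hu⟩ := h (Sum.inl w) ((stackLabel_top_eq_inl e e' P P').2 ⟨hq, hq'⟩)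
        cases hu
    · rintro ⟨q, hq, hq'⟩
      induction q using Quotient.inductionOn with
      | h w =>
        obtain ⟨u, hu⟩ := h (Sum.inr (Sum.inr w))
          ((stackLabel_bottom_eq_inl e e' P P').2 ⟨hq, hq'⟩)
        cases hu
  · rintro ⟨M, ⟨h, h'⟩, rfl⟩
    refine ⟨?_, ?_⟩
    · induction M using Quotient.inductionOn with
      | h v => exact ⟨Sum.inr (Sum.inl v), rfl⟩
    · rintro (v | v | v) hv
      · exact absurd ⟨_, (stackLabel_top_eq_inl e e' P P').1 hv⟩ h
      · exact ⟨v, rfl⟩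
      · exact absurd ⟨_, (stackLabel_bottom_eq_inl e e' P P').1 hv⟩ h'

/-- A label shared by the top and bottom rows must be a join class, since the other labels are
specific to one row. -/
theorem propagating_comp_doubled :
    propagating (comp (doubled e P) (doubled e' P')) =
      (toSupLeft e e' '' P ∩ toSupRight e e' '' P').ncard := by
  have hker : comp (doubled e P) (doubled e' P') =
      Setoid.ker (stackLabel e e' P P' ∘ outer) := by
    rw [comp, stack_doubled]; rfl
  rw [propagating, throughClasses, hker, ncard_classes_ker, ← Set.ncard_image_of_injective
    (toSupLeft e e' '' P ∩ toSupRight e e' '' P') Sum.inl_injective]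
  congr 1
  ext b
  constructor
  · rintro ⟨-, ⟨v, hv⟩, ⟨w, hw⟩⟩
    change stackLabel e e' P P' (Sum.inl v) = b at hv
    change stackLabel e e' P P' (Sum.inr (Sum.inr w)) = b at hw
    rcases b with M | q | q
    · exact ⟨M, ⟨⟨_, (stackLabel_top_eq_inl e e' P P').1 hv⟩,
        ⟨_, (stackLabel_bottom_eq_inl e e' P P').1 hw⟩⟩, rfl⟩
    · simp only [stackLabel, Sum.elim_inr] at hw
      split_ifs at hw
      simp at hw
    · simp only [stackLabel, Sum.elim_inl] at hv
      split_ifs at hv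
      simp at hv
  · rintro ⟨M, ⟨⟨q, hq, hM⟩, ⟨q', hq', hM'⟩⟩, rfl⟩
    induction q using Quotient.inductionOn with
    | h v =>
      induction q' using Quotient.inductionOn with
      | h w =>
        have hv := (stackLabel_top_eq_inl e e' P P').2 ⟨hq, hM⟩
        exact ⟨⟨Sum.inl v, hv⟩, ⟨v, hv⟩, ⟨w, (stackLabel_bottom_eq_inl e e' P P').2 ⟨hq', hM'⟩⟩⟩

end Stack

/-! ### Bounding loops by horizontal edges, and the equality case -/

section Comparison

/-- A set avoiding `f '' P` with as many elements as `Pᶜ` is the injective image of `Pᶜ`. -/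
theorem eq_image_compl_and_injOn {A B : Type*} [Finite A] {f : A → B}
    (hf : Function.Surjective f) {P : Set A} {L : Set B} (hL : ∀ M ∈ L, M ∉ f '' P)
    (hcard : L.ncard = Pᶜ.ncard) : f '' Pᶜ = L ∧ Set.InjOn f Pᶜ := by
  have hsub : L ⊆ f '' Pᶜ := fun M hM => by
    obtain ⟨q, rfl⟩ := hf M
    exact ⟨q, fun hq => hL _ hM ⟨q, hq, rfl⟩, rfl⟩
  have hle : (f '' Pᶜ).ncard ≤ Pᶜ.ncard := Set.ncard_image_le
  -- The chain |L| ≤ |f(Pᶜ)| ≤ |Pᶜ| = |L| collapses to equalities.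
  have heq : L = f '' Pᶜ := Set.eq_of_subset_of_ncard_le hsub (hcard ▸ hle)
  refine ⟨heq.symm, Set.injOn_of_ncard_image_eq ?_⟩
  rw [← heq, hcard]

theorem ncard_le_ncard_compl {A B : Type*} [Finite A] {f : A → B}
    (hf : Function.Surjective f) {P : Set A} {L : Set B} (hL : ∀ M ∈ L, M ∉ f '' P) :
    L.ncard ≤ Pᶜ.ncard := by
  have hsub : L ⊆ f '' Pᶜ := fun M hM => by
    obtain ⟨q, rfl⟩ := hf M
    exact ⟨q, fun hq => hL _ hM ⟨q, hq, rfl⟩, rfl⟩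
  exact (Set.ncard_le_ncard hsub).trans Set.ncard_image_le

variable {V : Type} {d d' : Diagram V}

theorem eq_of_injective_toSup {e e' : Setoid V} {P : Set (Quotient e)} {P' : Set (Quotient e')}
    (hf : Function.Injective (toSupLeft e e')) (hf' : Function.Injective (toSupRight e e'))
    (hP : toSupLeft e e' '' P = toSupRight e e' '' P') : doubled e P = doubled e' P' := by
  have he : e = e ⊔ e' := le_antisymm le_sup_left fun v w h =>
    Quotient.exact (hf (Quotient.sound h :
      toSupLeft e e' (Quotient.mk e v) = toSupLeft e e' (Quotient.mk e w)))
  have he' : e' = e ⊔ e' := le_antisymm le_sup_right fun v w h =>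
    Quotient.exact (hf' (Quotient.sound h :
      toSupRight e e' (Quotient.mk e' v) = toSupRight e e' (Quotient.mk e' w)))
  obtain rfl : e = e' := he.trans he'.symm
  have : toSupLeft e e = toSupRight e e := rfl
  rw [this] at hP
  rw [hf'.image_injective hP]

theorem toSupLeft_self_injective (e : Setoid V) : Function.Injective (toSupLeft e e) := by
  intro a b h
  induction a using Quotient.inductionOn with
  | h v =>
    induction b using Quotient.inductionOn with
    | h w =>
      have h' : (e ⊔ e) v w := Quotient.exact h
      rw [sup_idem] at h'
      exact Quotient.sound h'

theorem loops_self (hd : IsDoubled d) : loops d d = (topEdges d).ncard := by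
  obtain ⟨e, P, rfl⟩ := hd
  rw [loops_doubled, ncard_topEdges_doubled,
    ← Set.ncard_image_of_injective Pᶜ (toSupLeft_self_injective e),
    Set.image_compl_eq ⟨toSupLeft_self_injective e, toSupLeft_surjective e e⟩]
  congr 1
  ext M
  exact and_self_iff

theorem propagating_comp_self (hd : IsDoubled d) : propagating (comp d d) = propagating d := by
  obtain ⟨e, P, rfl⟩ := hd
  rw [propagating_comp_doubled, propagating_doubled,
    ← Set.ncard_image_of_injective P (toSupLeft_self_injective e)]
  congr 1
  exact Set.inter_self _

variable [Finite V]

theorem loops_le_left (hd : IsDoubled d) (hd' : IsDoubled d') :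
    loops d d' ≤ (topEdges d).ncard := by
  obtain ⟨e, P, rfl⟩ := hd
  obtain ⟨e', P', rfl⟩ := hd'
  rw [loops_doubled, ncard_topEdges_doubled]
  exact ncard_le_ncard_compl (toSupLeft_surjective e e') fun M hM => hM.1

theorem loops_le_right (hd : IsDoubled d) (hd' : IsDoubled d') :
    loops d d' ≤ (topEdges d').ncard := by
  obtain ⟨e, P, rfl⟩ := hd
  obtain ⟨e', P', rfl⟩ := hd'
  rw [loops_doubled, ncard_topEdges_doubled]
  exact ncard_le_ncard_compl (toSupRight_surjective e e') fun M hM => hM.2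

/-- Over the loops, both partitions restrict to the join: each loop comes from exactly one class
outside P and exactly one outside P'. -/
theorem topEdges_eq_of_loops_eq (hd : IsDoubled d) (hd' : IsDoubled d')
    (h : loops d d' = (topEdges d).ncard) (h' : loops d d' = (topEdges d').ncard) :
    topEdges d = topEdges d' := by
  obtain ⟨e, P, rfl⟩ := hd
  obtain ⟨e', P', rfl⟩ := hd'
  rw [loops_doubled, ncard_topEdges_doubled] at h h'
  obtain ⟨hL, hinj⟩ := eq_image_compl_and_injOn (toSupLeft_surjective e e') (fun M hM => hM.1) h
  obtain ⟨hL', hinj'⟩ :=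
    eq_image_compl_and_injOn (toSupRight_surjective e e') (fun M hM => hM.2) h'
  set L := {M | M ∉ toSupLeft e e' '' P ∧ M ∉ toSupRight e e' '' P'}
  have mem (v : V) : Quotient.mk e v ∉ P ↔ Quotient.mk (e ⊔ e') v ∈ L := by
    refine ⟨fun hv => hL ▸ ⟨_, hv, rfl⟩, fun hv hP => hv.1 ⟨_, hP, rfl⟩⟩
  have mem' (v : V) : Quotient.mk e' v ∉ P' ↔ Quotient.mk (e ⊔ e') v ∈ L := by
    refine ⟨fun hv => hL' ▸ ⟨_, hv, rfl⟩, fun hv hP => hv.2 ⟨_, hP, rfl⟩⟩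
  have key (v w : V) (hv : Quotient.mk (e ⊔ e') v ∈ L) : e v w ↔ e' v w := by
    have h1 : e v w ↔ (e ⊔ e') v w := by
      refine ⟨fun h => (le_sup_left : e ≤ e ⊔ e') h, fun h => ?_⟩
      have hvw : Quotient.mk (e ⊔ e') v = Quotient.mk (e ⊔ e') w := Quotient.sound h
      exact Quotient.exact (hinj ((mem v).2 hv) ((mem w).2 (hvw ▸ hv)) hvw)
    have h2 : e' v w ↔ (e ⊔ e') v w := by
      refine ⟨fun h => (le_sup_right : e' ≤ e ⊔ e') h, fun h => ?_⟩
      have hvw : Quotient.mk (e ⊔ e') v = Quotient.mk (e ⊔ e') w := Quotient.sound h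
      exact Quotient.exact (hinj' ((mem' v).2 hv) ((mem' w).2 (hvw ▸ hv)) hvw)
    exact h1.trans h2.symm
  ext C
  rw [mem_topEdges_doubled, mem_topEdges_doubled]
  refine exists_congr fun v => ?_
  rw [mem, mem']
  refine and_congr_right fun hv => ?_
  simp only [key v _ hv]

theorem eq_of_loops_eq (hd : IsDoubled d) (hd' : IsDoubled d')
    (h : loops d d' = (topEdges d).ncard) (h' : loops d d' = (topEdges d').ncard)
    (hp : propagating (comp d d') = propagating d)
    (hp' : propagating (comp d d') = propagating d') : d = d' := by
  obtain ⟨e, P, rfl⟩ := hd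
  obtain ⟨e', P', rfl⟩ := hd'
  rw [loops_doubled, ncard_topEdges_doubled] at h h'
  rw [propagating_comp_doubled, propagating_doubled] at hp hp'
  obtain ⟨hL, hinj⟩ := eq_image_compl_and_injOn (toSupLeft_surjective e e') (fun M hM => hM.1) h
  obtain ⟨hL', hinj'⟩ :=
    eq_image_compl_and_injOn (toSupRight_surjective e e') (fun M hM => hM.2) h'
  have hle : (toSupLeft e e' '' P).ncard ≤ P.ncard := Set.ncard_image_le
  have hle' : (toSupRight e e' '' P').ncard ≤ P'.ncard := Set.ncard_image_le
  -- |P| = |f(P) ∩ f'(P')| ≤ |f(P)| ≤ |P|, so f(P) lies in f'(P') and f is injective on P; the same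
  -- holds with the roles exchanged.
  have hI := Set.eq_of_subset_of_ncard_le
    (Set.inter_subset_left : toSupLeft e e' '' P ∩ toSupRight e e' '' P' ⊆ _) (by lia)
  have hI' := Set.eq_of_subset_of_ncard_le
    (Set.inter_subset_right : toSupLeft e e' '' P ∩ toSupRight e e' '' P' ⊆ _) (by lia)
  have hPinj : Set.InjOn (toSupLeft e e') P :=
    Set.injOn_of_ncard_image_eq (by rw [← hI, hp])
  have hPinj' : Set.InjOn (toSupRight e e') P' :=
    Set.injOn_of_ncard_image_eq (by rw [← hI', hp'])
  refine eq_of_injective_toSup ?_ ?_ (hI.symm.trans hI')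
  · rw [← Set.injOn_univ, ← Set.union_compl_self P, Set.injOn_union disjoint_compl_right]
    refine ⟨hPinj, hinj, fun a ha b hb hab => ?_⟩
    have hb' := hL ▸ Set.mem_image_of_mem (toSupLeft e e') hb
    exact hb'.1 ⟨a, ha, hab⟩
  · rw [← Set.injOn_univ, ← Set.union_compl_self P', Set.injOn_union disjoint_compl_right]
    refine ⟨hPinj', hinj', fun a ha b hb hab => ?_⟩
    have hb' := hL' ▸ Set.mem_image_of_mem (toSupRight e e') hb
    exact hb'.2 ⟨a, ha, hab⟩

/-- The comparison of loops for a diagram `d'` with at most as many horizontal edges as `d`. -/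
theorem loops_lt_of_ne {t : ℕ} (hd : IsDoubled d) (hd' : IsDoubled d') (ht : propagating d = t)
    (ht' : propagating d' = t) (hne : d ≠ d')
    (hle : (topEdges d').ncard ≤ (topEdges d).ncard) :
    loops d d' ≤ loops d d ∧
      (propagating (comp d d') = t ∨ topEdges d' ≠ topEdges d → loops d d' < loops d d) := by
  have h1 := loops_le_left hd hd'
  have h2 := loops_le_right hd hd'
  rw [loops_self hd]
  refine ⟨h1, fun h => lt_of_le_of_ne h1 fun heq => ?_⟩
  -- Equality for d squeezes: loops ≤ edges of d' ≤ edges of d = loops.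
  have heq' : loops d d' = (topEdges d').ncard := by lia
  rcases h with h | h
  · exact hne (eq_of_loops_eq hd hd' heq heq' (h.trans ht.symm) (h.trans ht'.symm))
  · exact h (topEdges_eq_of_loops_eq hd hd' heq heq').symm

end Comparison

/-! ### Monic determinants from a degree bound -/

section Determinant

/-- Bounding degrees by the mean of N i and N j requires no order on the indices: along a
permutation, both N (σ i) and N i sum to ∑ N, the degree of the diagonal product. -/
theorem monic_det_of_natDegree {R ι : Type*} [CommRing R] [Nontrivial R] [Fintype ι]
    [DecidableEq ι] (A : Matrix ι ι R[X]) (N : ι → ℕ) (hdiag : ∀ i, A i i = X ^ N i)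
    (hoff : ∀ i j, i ≠ j → A i j ≠ 0 → 2 * (A i j).natDegree < N i + N j) : A.det.Monic := by
  have hle (i j : ι) (h0 : A i j ≠ 0) : 2 * (A i j).natDegree ≤ N i + N j := by
    rcases eq_or_ne i j with rfl | h
    · rw [hdiag, natDegree_X_pow]; lia
    · exact (hoff i j h h0).le
  have hprod : (∏ i, A i i) = X ^ ∑ i, N i := by
    simp only [hdiag, Finset.prod_pow_eq_pow_sum]
  rw [Matrix.det_apply, ← Finset.add_sum_erase _ _ (Finset.mem_univ (1 : Equiv.Perm ι))]
  simp only [Equiv.Perm.sign_one, one_smul, Equiv.Perm.one_apply, hprod]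
  refine monic_X_pow_add ?_
  refine (degree_sum_le _ _).trans_lt ((Finset.sup_lt_iff (WithBot.bot_lt_coe _)).2 fun σ hσ => ?_)
  have hsign : (Equiv.Perm.sign σ • ∏ i, A (σ i) i).degree = (∏ i, A (σ i) i).degree := by
    rcases Int.units_eq_one_or (Equiv.Perm.sign σ) with h | h <;> simp [h]
  rw [hsign]
  by_cases h0 : ∏ i, A (σ i) i = 0
  · rw [h0, degree_zero]
    exact WithBot.bot_lt_coe _
  have h0' (i : ι) : A (σ i) i ≠ 0 := fun h => h0 (Finset.prod_eq_zero (Finset.mem_univ i) h)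
  obtain ⟨i, hi⟩ : ∃ i, σ i ≠ i := by
    by_contra! h
    exact (Finset.mem_erase.1 hσ).1 (Equiv.ext h)
  -- One moved index makes the summed inequality strict.
  have hlt : ∑ i, 2 * (A (σ i) i).natDegree < ∑ i, (N (σ i) + N i) :=
    Finset.sum_lt_sum (fun i _ => hle _ _ (h0' i)) ⟨i, Finset.mem_univ i, hoff _ _ hi (h0' i)⟩
  rw [← Finset.mul_sum, Finset.sum_add_distrib, Equiv.sum_comp σ N] at hlt
  refine degree_le_natDegree.trans_lt (Nat.cast_lt.2 ?_)
  exact (natDegree_prod_le _ _).trans_lt (by lia)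

theorem monic_det_gram {V : Type} [Finite V] (R : Type*) [CommRing R] [Nontrivial R]
    (S : Set (Diagram V)) (t : ℕ) (hS : ∀ d ∈ S, IsDoubled d ∧ propagating d = t) :
    (gram R S t).det.Monic := by
  refine monic_det_of_natDegree _ (fun d => (topEdges d.1).ncard) (fun d => ?_) ?_
  · obtain ⟨h, h'⟩ := hS d.1 d.2
    rw [gram, if_pos ((propagating_comp_self h).trans h'), loops_self h]
  · intro d d' hne h0
    obtain ⟨h, hp⟩ := hS d.1 d.2
    obtain ⟨h', hp'⟩ := hS d'.1 d'.2
    simp only [gram] at h0 ⊢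
    split_ifs at h0 ⊢ with hc
    · rw [natDegree_X_pow]
      have h1 := loops_le_left h h'
      have h2 := loops_le_right h h'
      -- If the mean bound failed, the loop number would equal both edge counts, forcing d = d'.
      by_contra hcon
      exact hne (Subtype.ext (eq_of_loops_eq h h' (by lia) (by lia) (hc.trans hp.symm)
        (hc.trans hp'.symm)))
    · exact absurd rfl h0

end Determinant

/-! ### ℤ₂-stable diagrams and the ordering rules -/

section Signed

variable {k : ℕ}

theorem act_zero (x : Row k ⊕ Row k) : act 0 x = x := by
  rcases x with x | x <;> simp [act]

theorem act_act (g h : ZMod 2) (x : Row k ⊕ Row k) : act g (act h x) = act (g + h) x := by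
  rcases x with x | x <;> simp [act, add_assoc]

theorem act_one_act_one (x : Row k ⊕ Row k) : act 1 (act 1 x) = x := by
  rw [act_act, show (1 + 1 : ZMod 2) = 0 from rfl, act_zero]

theorem zmod_two_cases (g : ZMod 2) : g = 0 ∨ g = 1 := by
  revert g; decide

theorem orbitMap_act (g : ZMod 2) (x : Row k ⊕ Row k) :
    (Sum.map Prod.fst Prod.fst (act g x) : Fin k ⊕ Fin k) = Sum.map Prod.fst Prod.fst x := by
  rcases x with x | x <;> simp [act]

theorem eq_or_eq_act_of_orbitMap_eq {x y : Row k ⊕ Row k}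
    (h : (Sum.map Prod.fst Prod.fst x : Fin k ⊕ Fin k) = Sum.map Prod.fst Prod.fst y) :
    y = x ∨ y = act 1 x := by
  have key (a b : ZMod 2) : b = a ∨ b = 1 + a := by revert a b; decide
  rcases x with ⟨i, a⟩ | ⟨i, a⟩ <;> rcases y with ⟨j, b⟩ | ⟨j, b⟩ <;>
    simp only [Sum.map_inl, Sum.map_inr, Sum.inl.injEq, Sum.inr.injEq, reduceCtorEq] at h <;>
    subst h <;> rcases key a b with rfl | rfl <;> simp [act]

variable {d : Diagram (Row k)}

theorem act_one_image_class (hd : IsStable d) (y : Row k ⊕ Row k) :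
    act 1 '' {x | d x y} = {x | d x (act 1 y)} := by
  ext x
  constructor
  · rintro ⟨z, hz, rfl⟩
    exact hd 1 _ _ hz
  · intro hx
    refine ⟨act 1 x, ?_, act_one_act_one x⟩
    have := hd 1 _ _ hx
    rwa [act_one_act_one] at this

theorem orbits_act_image (g : ZMod 2) (C : Set (Row k ⊕ Row k)) :
    orbits (act g '' C) = orbits C := by
  rw [orbits, Set.image_image, orbits]
  simp only [orbitMap_act]

theorem eq_of_mem_classes {C C' : Set (Row k ⊕ Row k)} (hC : C ∈ d.classes) (hC' : C' ∈ d.classes)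
    {x : Row k ⊕ Row k} (hx : x ∈ C) (hx' : x ∈ C') : C = C' :=
  Setoid.eq_of_mem_classes hC hx hC' hx'

theorem eq_or_eq_act_image_of_orbits_eq (hd : IsStable d) {C C' : Set (Row k ⊕ Row k)}
    (hC : C ∈ d.classes) (hC' : C' ∈ d.classes) (h : orbits C = orbits C') :
    C' = C ∨ C' = act 1 '' C := by
  obtain ⟨y, rfl⟩ := id hC
  have hy : Sum.map Prod.fst Prod.fst y ∈ orbits C' := h ▸ ⟨y, d.refl y, rfl⟩
  obtain ⟨z, hz, hzy⟩ := hy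
  rcases eq_or_eq_act_of_orbitMap_eq hzy.symm with rfl | rfl
  · exact Or.inl (eq_of_mem_classes hC' hC hz (d.refl _))
  · right
    rw [act_one_image_class hd]
    exact eq_of_mem_classes hC' (d.mem_classes _) hz (d.refl _)

/-- The stabilizer of a class is a subgroup of ℤ₂, hence trivial or everything; by stability, one
point moved within its class decides. -/
theorem isEComp_iff_not_isZComp (hd : IsStable d) {C : Set (Row k ⊕ Row k)} (hC : C ∈ d.classes) :
    IsEComp C ↔ ¬ IsZComp C := by
  obtain ⟨y, rfl⟩ := hC
  constructor
  · intro hE hZ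
    exact absurd (hE y (d.refl y) 1 (hZ y (d.refl y) 1)) (by decide)
  · intro hZ x hx g hg
    refine (zmod_two_cases g).resolve_right fun h => hZ fun z hz g' => ?_
    subst h
    rcases zmod_two_cases g' with rfl | rfl
    · rwa [act_zero]
    · exact d.trans (hd 1 _ _ (d.trans hz (d.symm hx))) hg

/-- The `{e}`-components come in pairs with a common image in the quotient by `ℤ₂`. -/
theorem ncard_eq_two_mul_add (hd : IsStable d) {S : Set (Set (Row k ⊕ Row k))}
    (hS : S ⊆ d.classes) (hact : ∀ C ∈ S, act 1 '' C ∈ S) :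
    S.ncard = 2 * (orbits '' {C | C ∈ S ∧ IsEComp C}).ncard +
      (orbits '' {C | C ∈ S ∧ IsZComp C}).ncard := by
  classical
  -- Classes with the same orbits are equal or translates of each other, and a ℤ₂-component is its
  -- own translate.
  have hZ : (orbits '' {C | C ∈ S ∧ IsZComp C}).ncard = {C | C ∈ S ∧ IsZComp C}.ncard := by
    apply Set.InjOn.ncard_image
    rintro C ⟨hC, hCZ⟩ C' ⟨hC', -⟩ h
    rcases eq_or_eq_act_image_of_orbits_eq hd (hS hC) (hS hC') h with h' | h'
    · exact h'.symm
    · obtain ⟨y, rfl⟩ := hS hC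
      refine eq_of_mem_classes (x := act 1 y) (hS hC) (hS hC') (hCZ y (d.refl y) 1) ?_
      rw [h']
      exact ⟨y, d.refl y, rfl⟩
  -- Each fibre of `orbits` on {e}-components is {C, `act 1 '' C`}, with two distinct members.
  have hE : {C | C ∈ S ∧ IsEComp C}.ncard =
      2 * (orbits '' {C | C ∈ S ∧ IsEComp C}).ncard := by
    have hmem (C) : C ∈ (Set.toFinite {C | C ∈ S ∧ IsEComp C}).toFinset ↔ C ∈ S ∧ IsEComp C := by
      simp
    rw [← Set.Finite.coe_toFinset (Set.toFinite {C | C ∈ S ∧ IsEComp C}), ← Finset.coe_image,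
      Set.ncard_coe_finset, Set.ncard_coe_finset, mul_comm, ← smul_eq_mul, ← Finset.sum_const,
      Finset.card_eq_sum_card_image orbits]
    refine Finset.sum_congr rfl fun b hb => ?_
    obtain ⟨C, hC, rfl⟩ := Finset.mem_image.1 hb
    rw [hmem] at hC
    have hE' : IsEComp (act 1 '' C) := by
      rintro _ ⟨x, hx, rfl⟩ g hg
      obtain ⟨z, hz, hzg⟩ := hg
      refine hC.2 x hx g ?_
      have := congrArg (act 1) hzg
      rw [act_one_act_one, act_act, act_act, add_right_comm,
        show (1 + 1 : ZMod 2) = 0 from rfl, zero_add] at this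
      rwa [← this]
    have hne : C ≠ act 1 '' C := fun h => by
      obtain ⟨y, rfl⟩ := hS hC.1
      have h1 : act 1 y ∈ {x | d x y} := by
        rw [h]
        exact ⟨y, d.refl y, rfl⟩
      exact absurd (hC.2 y (d.refl y) 1 h1) (by decide)
    refine Eq.trans (congrArg Finset.card ?_) (Finset.card_pair hne)
    ext C'
    rw [Finset.mem_filter, hmem, Finset.mem_insert, Finset.mem_singleton]
    constructor
    · rintro ⟨⟨hC', -⟩, h⟩
      exact eq_or_eq_act_image_of_orbits_eq hd (hS hC.1) (hS hC') h.symm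
    · rintro (rfl | rfl)
      · exact ⟨hC, rfl⟩
      · exact ⟨⟨hact C hC.1, hE'⟩, orbits_act_image 1 C⟩
  rw [hZ, ← hE, ← Set.ncard_union_eq]
  · congr 1
    ext C
    constructor
    · intro hC
      by_cases h : IsZComp C
      · exact Or.inr ⟨hC, h⟩
      · exact Or.inl ⟨hC, (isEComp_iff_not_isZComp hd (hS hC)).2 h⟩
    · rintro (h | h) <;> exact h.1
  · rw [Set.disjoint_left]
    rintro C ⟨hC, hCE⟩ ⟨-, hCZ⟩
    exact (isEComp_iff_not_isZComp hd (hS hC)).1 hCE hCZ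

theorem act_one_image_mem_classes (hd : IsStable d) {C : Set (Row k ⊕ Row k)}
    (hC : C ∈ d.classes) : act 1 '' C ∈ d.classes := by
  obtain ⟨y, rfl⟩ := hC
  rw [act_one_image_class hd]
  exact d.mem_classes _

theorem propagating_eq_of_isStable (hd : IsStable d) :
    propagating d = 2 * (eThrough d).ncard + (zThrough d).ncard := by
  refine ncard_eq_two_mul_add hd (fun C hC => hC.1) ?_
  rintro C ⟨hC, ⟨v, hv⟩, ⟨w, hw⟩⟩
  exact ⟨act_one_image_mem_classes hd hC, ⟨_, Sum.inl v, hv, rfl⟩, ⟨_, Sum.inr w, hw, rfl⟩⟩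

/-- This identifies the first ordering key with the quantity that bounds the loops. -/
theorem ncard_topEdges_of_isStable (hd : IsStable d) :
    (topEdges d).ncard = 2 * r1 d + r2 d := by
  refine ncard_eq_two_mul_add hd (fun C hC => hC.1) ?_
  rintro C ⟨hC, h⟩
  refine ⟨act_one_image_mem_classes hd hC, ?_⟩
  rintro _ ⟨x, hx, rfl⟩
  obtain ⟨v, rfl⟩ := h x hx
  exact ⟨_, rfl⟩

theorem propagating_of_mem_J {s₁ s₂ : ℕ} (hd : d ∈ J k s₁ s₂) : propagating d = 2 * s₁ + s₂ := by
  rw [propagating_eq_of_isStable hd.1, hd.2.2.1, hd.2.2.2]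

/-- Stated for any subset of `J` so that it serves both the ℤ₂-relation and the signed case. -/
theorem loops_lt_of_isIndexOrder {s₁ s₂ : ℕ} {S : Set (Diagram (Row k))} (hS : S ⊆ J k s₁ s₂)
    {lt : Shape → Shape → Prop} {r : S → S → Prop} (hr : IsIndexOrder S lt r) (di dj : S)
    (hij : r dj di) :
    loops di.1 dj.1 ≤ loops di.1 di.1 ∧
      (propagating (comp di.1 dj.1) = 2 * s₁ + s₂ ∨ (r1 dj.1, r2 dj.1) ≠ (r1 di.1, r2 di.1) →
        loops di.1 dj.1 < loops di.1 di.1) := by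
  have := hr.1
  have hi := hS di.2
  have hj := hS dj.2
  have hne : di.1 ≠ dj.1 := fun h => by
    obtain rfl : di = dj := Subtype.ext h
    exact irrefl_of r di hij
  have hle : (topEdges dj.1).ncard ≤ (topEdges di.1).ncard := by
    rw [ncard_topEdges_of_isStable hi.1, ncard_topEdges_of_isStable hj.1]
    -- If dj had more top edges than di, the first key would put di before dj.
    by_contra! h
    exact asymm_of r hij (hr.2 di dj (Or.inl h))
  obtain ⟨h1, h2⟩ := loops_lt_of_ne hi.2.1 hj.2.1 (propagating_of_mem_J hi)
    (propagating_of_mem_J hj) hne hle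
  -- r₁ and r₂ are computed from the set of top edges, so different pairs force different sets.
  refine ⟨h1, fun h => h2 (h.imp_right fun h h' => h ?_)⟩
  simp only [r1, r2, eEdges, zEdges, h']

theorem loops_lt_of_isIndexOrderPlain {s : ℕ}
    {lt : Multiset ℕ × Multiset ℕ → Multiset ℕ × Multiset ℕ → Prop}
    {r : JPlain k s → JPlain k s → Prop} (hr : IsIndexOrderPlain (JPlain k s) lt r)
    (di dj : JPlain k s) (hij : r dj di) :
    loops di.1 dj.1 ≤ loops di.1 di.1 ∧
      (propagating (comp di.1 dj.1) = s ∨ rPlain dj.1 ≠ rPlain di.1 →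
        loops di.1 dj.1 < loops di.1 di.1) := by
  have := hr.1
  have hne : di.1 ≠ dj.1 := fun h => by
    obtain rfl : di = dj := Subtype.ext h
    exact irrefl_of r di hij
  have hle : (topEdges dj.1).ncard ≤ (topEdges di.1).ncard := by
    by_contra! h
    exact asymm_of r hij (hr.2 di dj (Or.inl h))
  obtain ⟨h1, h2⟩ := loops_lt_of_ne di.2.1 dj.2.1 di.2.2 dj.2.2 hne hle
  exact ⟨h1, fun h => h2 (h.imp_right fun h h' => h (by rw [rPlain, rPlain, h']))⟩

end Signed

end GramDiag

theorem lemma3p9 (R : Type*) [CommRing R] [Nontrivial R] (k s₁ s₂ s : ℕ) :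
    -- the algebra of `ℤ₂`-relations
    (∀ lt : GramDiag.Shape → GramDiag.Shape → Prop, IsStrictTotalOrder GramDiag.Shape lt →
      ∀ r : GramDiag.J k s₁ s₂ → GramDiag.J k s₁ s₂ → Prop,
        GramDiag.IsIndexOrder (GramDiag.J k s₁ s₂) lt r →
        ∀ di dj : GramDiag.J k s₁ s₂, r dj di →
          GramDiag.loops di.1 dj.1 ≤ GramDiag.loops di.1 di.1 ∧
          (GramDiag.propagating (GramDiag.comp di.1 dj.1) = 2 * s₁ + s₂ ∨
              (GramDiag.r1 dj.1, GramDiag.r2 dj.1) ≠ (GramDiag.r1 di.1, GramDiag.r2 di.1) →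
            GramDiag.loops di.1 dj.1 < GramDiag.loops di.1 di.1)) ∧
    -- the signed partition algebra
    (∀ lt : GramDiag.Shape → GramDiag.Shape → Prop, IsStrictTotalOrder GramDiag.Shape lt →
      ∀ r : GramDiag.JSigned k s₁ s₂ → GramDiag.JSigned k s₁ s₂ → Prop,
        GramDiag.IsIndexOrder (GramDiag.JSigned k s₁ s₂) lt r →
        ∀ di dj : GramDiag.JSigned k s₁ s₂, r dj di →
          GramDiag.loops di.1 dj.1 ≤ GramDiag.loops di.1 di.1 ∧
          (GramDiag.propagating (GramDiag.comp di.1 dj.1) = 2 * s₁ + s₂ ∨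
              (GramDiag.r1 dj.1, GramDiag.r2 dj.1) ≠ (GramDiag.r1 di.1, GramDiag.r2 di.1) →
            GramDiag.loops di.1 dj.1 < GramDiag.loops di.1 di.1)) ∧
    -- the partition algebra
    (∀ lt : Multiset ℕ × Multiset ℕ → Multiset ℕ × Multiset ℕ → Prop,
      IsStrictTotalOrder (Multiset ℕ × Multiset ℕ) lt →
      ∀ r : GramDiag.JPlain k s → GramDiag.JPlain k s → Prop,
        GramDiag.IsIndexOrderPlain (GramDiag.JPlain k s) lt r →
        ∀ di dj : GramDiag.JPlain k s, r dj di →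
          GramDiag.loops di.1 dj.1 ≤ GramDiag.loops di.1 di.1 ∧
          (GramDiag.propagating (GramDiag.comp di.1 dj.1) = s ∨
              GramDiag.rPlain dj.1 ≠ GramDiag.rPlain di.1 →
            GramDiag.loops di.1 dj.1 < GramDiag.loops di.1 di.1)) ∧
    -- the determinants
    ((GramDiag.gram R (GramDiag.J k s₁ s₂) (2 * s₁ + s₂)).det ≠ 0 ∧
      (GramDiag.gram R (GramDiag.J k s₁ s₂) (2 * s₁ + s₂)).det.Monic) ∧
    ((GramDiag.gram R (GramDiag.JSigned k s₁ s₂) (2 * s₁ + s₂)).det ≠ 0 ∧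
      (GramDiag.gram R (GramDiag.JSigned k s₁ s₂) (2 * s₁ + s₂)).det.Monic) ∧
    ((GramDiag.gram R (GramDiag.JPlain k s) s).det ≠ 0 ∧
      (GramDiag.gram R (GramDiag.JPlain k s) s).det.Monic) := by
  refine ⟨fun lt _ r hr di dj h => GramDiag.loops_lt_of_isIndexOrder subset_rfl hr di dj h,
    fun lt _ r hr di dj h => GramDiag.loops_lt_of_isIndexOrder (fun _ h => h.1) hr di dj h,
    fun lt _ r hr di dj h => GramDiag.loops_lt_of_isIndexOrderPlain hr di dj h, ?_, ?_, ?_⟩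
  · have h := GramDiag.monic_det_gram R (GramDiag.J k s₁ s₂) (2 * s₁ + s₂)
      fun d hd => ⟨hd.2.1, GramDiag.propagating_of_mem_J hd⟩
    exact ⟨h.ne_zero, h⟩
  · have h := GramDiag.monic_det_gram R (GramDiag.JSigned k s₁ s₂) (2 * s₁ + s₂)
      fun d hd => ⟨hd.1.2.1, GramDiag.propagating_of_mem_J hd.1⟩
    exact ⟨h.ne_zero, h⟩
  · have h := GramDiag.monic_det_gram R (GramDiag.JPlain k s) s fun d hd => hd
    exact ⟨h.ne_zero, h⟩
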